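/- Let $D$ be a finite set, $n\ge 0$, $\mathcal D\subseteq D^n$, and let $f:\mathcal D\to\{0,1\}$ be a boolean function. Put $F(x,y)=\delta_{f(x),f(y)}$, $\sigma_f(x,y)=(-1)^{f(x)+f(y)}$, $\Delta_i(x,y)=\delta_{x_i,y_i}$ for $x,y\in\mathcal D$ and $1\le i\le n$; let $I$ be the identity matrix, $J$ the all-ones matrix and $\circ$ the entrywise matrix product. The additive adversary bound of $F$ is $$\mathrm{ADV}(F)=\max\bigl\{\|\Gamma\circ(J-F)\| : \Gamma \text{ a Hermitian } |\mathcal D|\times|\mathcal D| \text{ matrix with } I\pm\Gamma\circ(J-\Delta_i)\succeq 0 \text{ for all } i\bigr\},$$ where $\|\cdot\|$ is the spectral norm. For an integer $k>0$ let $\oplus\circ f^{(k)}:\mathcal D^k\to\{0,1\}$, $(x^1,\dots,x^k)\mapsto f(x^1)\oplus\cdots\oplus f(x^k)$, and $\sigma_f^{\otimes k}(x,y)=\prod_{p}\sigma_f(x^p,y^p)$ for $x,y\in\mathcal D^k$. A $T$-query quantum algorithm on input $z$ prepares $U_TO_zU_{T-1}\cdots O_zU_0|\bar 0\rangle$ with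 input-independent unitaries $U_t$, where $O_z|i,b,w\rangle=|i,b+z_i,w\rangle$; here the query register $i$ ranges over the positions of the input and a null index on which $O_z$ is the identity, the work register $w$ is finite-dimensional of arbitrary size, and $b$ ranges over a finite abelian group in which the symbols of $D$ are encoded injectively (group and encoding are arbitrary, but fixed). $Q_\epsilon(g)$ is the minimum $T$ for which some $T$-query algorithm, followed by a measurement of its final state, outputs $g(z)$ with probability at least $1-\epsilon$ for every input $z$. $Q^c_\epsilon(\sigma)$ is the minimum $T$ for which there are a $T$-query algorithm with final states $|P(z)\rangle$ and vectors $|\tau_z\rangle$ in its state space with $\langle\tau_x|\tau_y\rangle=\sigma(x,y)$ for all inputs $x,y$, such that $\mathrm{Re}\,\langle P(z)|\tau_z\rangle\ge\sqrt{1-\epsilon}$ for every input $z$. Then for every $0\le\delta\le 1$ and every integer $k>0$: 1. (strong direct product theorem for computing $f$ in the phase) $\displaystyle Q^c_{1-\delta^k}\bigl(\sigma_f^{\otimes k}\bigr)\ \ge\ \frac{k\delta}{4}\,\mathrm{ADV}(F)$; 2. (XOR Lemma) $\displaystyle Q_{(1-\delta^{k/2})/2}\bigl(\oplus\circ f^{(k)}\bigr)\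 \ge\ \frac{k\delta}{8}\,\mathrm{ADV}(F)$. -/

import Mathlib

open scoped ENNReal Matrix ComplexOrder

noncomputable section

/-- Computational basis states `|i, b, w⟩` of a query algorithm: a query register `i` (an index
into the input string, or `none` for "no query"), an answer register `b` with values in a finite
abelian group `G`, and a work register of arbitrary finite size. -/
abbrev BasisState (ι G : Type*) (m : ℕ) : Type _ := Option ι × G × Fin (m + 1)

/-- The Hilbert space of the algorithm. -/
abbrev StateSpace (ι G : Type*) (m : ℕ) : Type _ := EuclideanSpace ℂ (BasisState ι G m)

/-- The permutation `|i, b, w⟩ ↦ |i, b + z_i, w⟩` of the basis states (`|none, b, w⟩` is fixed). -/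
def queryPerm {ι G : Type*} [AddCommGroup G] (m : ℕ) (z : ι → G) :
    Equiv.Perm (BasisState ι G m) where
  toFun s := (s.1, s.2.1 + s.1.elim 0 z, s.2.2)
  invFun s := (s.1, s.2.1 - s.1.elim 0 z, s.2.2)
  left_inv := by
    rintro ⟨i, b, w⟩
    simp
  right_inv := by
    rintro ⟨i, b, w⟩
    simp

/-- The oracle gate: the unitary which permutes the basis states by `queryPerm`. -/
def oracle {ι G : Type*} [Fintype ι] [Fintype G] [AddCommGroup G] (m : ℕ) (z : ι → G) :
    StateSpace ι G m ≃ₗᵢ[ℂ] StateSpace ι G m :=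
  LinearIsometryEquiv.piLpCongrLeft 2 ℂ ℂ (queryPerm m z)

/-- A quantum query algorithm: the size of its work register and the input-independent
unitaries `U₀, U₁, …`. When it is run with `T` queries only `U₀, …, U_T` matter. -/
structure QueryAlgorithm (ι G : Type*) [Fintype ι] [Fintype G] where
  workSize : ℕ
  gate : ℕ → (StateSpace ι G workSize ≃ₗᵢ[ℂ] StateSpace ι G workSize)

/-- The state `U_T O_z U_{T-1} O_z ⋯ O_z U₀ |none, 0, 0⟩` after `T` queries to the input string
`z`. -/
def QueryAlgorithm.state {ι G : Type*} [Fintype ι] [Fintype G] [AddCommGroup G]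
    (A : QueryAlgorithm ι G) (z : ι → G) : ℕ → StateSpace ι G A.workSize
  | 0 => by
      classical
      exact A.gate 0 (EuclideanSpace.single (none, 0, 0) 1)
  | T + 1 => A.gate (T + 1) (oracle A.workSize z (A.state z T))

/-- With `T` queries, for every input `x : X`, presented to the algorithm as the string
`enc ∘ str x`, the algorithm `A` outputs `g x` with probability at least `1 - ε`. The output is
obtained by measuring the final state in the computational basis and reading off the value `out`
of the outcome. -/
def ComputesWithError {X ι D G E : Type*} [Fintype ι] [Fintype G] [AddCommGroup G] [DecidableEq E]
    (enc : D ↪ G) (str : X → ι → D) (g : X → E) (ε : ℝ) (T : ℕ) : Prop :=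
  ∃ (A : QueryAlgorithm ι G) (out : BasisState ι G A.workSize → E),
    ∀ x : X, 1 - ε ≤
      ∑ s : BasisState ι G A.workSize with out s = g x, ‖A.state (fun i => enc (str x i)) T s‖ ^ 2

/-- The quantum query complexity `Q_ε(g)`: the least number of queries of an algorithm that
computes `g` with error at most `ε` on every input. -/
def quantumQuery {X ι D G E : Type*} [Fintype ι] [Fintype G] [AddCommGroup G] [DecidableEq E]
    (enc : D ↪ G) (str : X → ι → D) (g : X → E) (ε : ℝ) : ℕ∞ :=
  ⨅ (T : ℕ) (_ : ComputesWithError enc str g ε T), (T : ℕ∞)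

/-- With `T` queries, the state generation problem with target Gram matrix `σ` is solved coherently
with error at most `ε`: there are target vectors `τ_x` with `⟨τ_x, τ_y⟩ = σ(x, y)` in the final
space such that `Re ⟨P(x), τ_x⟩ ≥ √(1 - ε)` for the final states `P(x)`. The `τ_x` are fixed up to a
unitary by `σ`, so they may be thought of as `σ_x ⊗ 0̄` for a default workspace state `0̄`. -/
def GeneratesCoherently {X ι D G : Type*} [Fintype ι] [Fintype G] [AddCommGroup G]
    (enc : D ↪ G) (str : X → ι → D) (σ : Matrix X X ℂ) (ε : ℝ) (T : ℕ) : Prop :=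
  ∃ (A : QueryAlgorithm ι G) (τ : X → StateSpace ι G A.workSize),
    (∀ x y : X, inner ℂ (τ x) (τ y) = σ x y) ∧
    ∀ x : X, √(1 - ε) ≤ (inner ℂ (A.state (fun i => enc (str x i)) T) (τ x)).re

/-- The coherent quantum query complexity `Q^c_ε(σ)` of generating `σ`. -/
def coherentQuery {X ι D G : Type*} [Fintype ι] [Fintype G] [AddCommGroup G]
    (enc : D ↪ G) (str : X → ι → D) (σ : Matrix X X ℂ) (ε : ℝ) : ℕ∞ :=
  ⨅ (T : ℕ) (_ : GeneratesCoherently enc str σ ε T), (T : ℕ∞)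

/-- The all-ones matrix `J`. -/
def allOnes (X : Type*) : Matrix X X ℂ := fun _ _ => 1

/-- The matrix `Δ_i(x, y) = δ_{x_i, y_i}`. -/
def agreeMatrix {X ι D : Type*} [DecidableEq D] (str : X → ι → D) (i : ι) : Matrix X X ℂ :=
  fun x y => if str x i = str y i then 1 else 0

/-- The Gram matrix `F(x, y) = δ_{f(x), f(y)}`. -/
def functionGram {X E : Type*} [DecidableEq E] (f : X → E) : Matrix X X ℂ :=
  fun x y => if f x = f y then 1 else 0

/-- The Gram matrix `σ_f(x, y) = (-1)^{f(x) + f(y)}` of computing `f` in the phase. -/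
def phaseGram {X : Type*} (f : X → ZMod 2) : Matrix X X ℂ :=
  fun x y => (-1) ^ ((f x).val + (f y).val)

/-- The tensor power `σ^{⊗ k}`, with rows and columns indexed by `k`-tuples. -/
def tensorPower {X : Type*} (k : ℕ) (σ : Matrix X X ℂ) : Matrix (Fin k → X) (Fin k → X) ℂ :=
  fun x y => ∏ p, σ (x p) (y p)

/-- A `k`-tuple of inputs as one string, with positions `(p, i)`. -/
def tupleString {X ι D : Type*} (k : ℕ) (str : X → ι → D) (x : Fin k → X) : Fin k × ι → D :=
  fun q => str (x q.1) q.2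

/-- The parity `⊕ ∘ f^{(k)}` of `k` independent copies of `f`. -/
def parityOfCopies {X : Type*} (k : ℕ) (f : X → ZMod 2) (x : Fin k → X) : ZMod 2 :=
  ∑ p, f (x p)

/-- The additive adversary bound: the supremum of the spectral norms `‖Γ ∘ (J - σ)‖` over Hermitian
matrices `Γ` with `I ± Γ ∘ (J - Δ_i) ⪰ 0` for all `i`, where `∘` is the entrywise product. -/
def additiveAdversary {X ι D : Type*} [Fintype X] [DecidableEq X] [DecidableEq D]
    (str : X → ι → D) (σ : Matrix X X ℂ) : ℝ≥0∞ :=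
  ⨆ (Γ : Matrix X X ℂ)
    (_ : Γ.IsHermitian ∧ ∀ i : ι,
      (1 + Γ ⊙ (allOnes X - agreeMatrix str i)).PosSemidef ∧
      (1 - Γ ⊙ (allOnes X - agreeMatrix str i)).PosSemidef),
    ENNReal.ofReal ‖Matrix.toEuclideanCLM (𝕜 := ℂ) (Γ ⊙ (allOnes X - σ))‖

end

/-! The proof turns an additive adversary matrix into a multiplicative one, which behaves well under
tensor powers. For feasible Γ put A = Γ ∘ (J - F) and l = ‖A‖. This A is again feasible
(`IsAdversaryMatrix.hadamard_functionGram`) and bipartite with respect to f, so conjugation by the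
signs (-1)^f negates it: a unit eigenvector v for l gives the eigenvector w = (-1)^f v for -l. For γ
≥ 0 the matrix M = 1 + γ(l - A) satisfies M ⪰ 1, M v = v and M w = (1 + 2γl) w.

Weight the states of the algorithm by v^{⊗k} and follow the `progress` of M^{⊗k}. It starts at 1, is
invariant under the gates, and grows by a factor of at most 1 + 2γ per query
(`progress_comp_perm_le`, `IsAdversaryMatrix.queryBounded_tensorPower`). Coherent success means
overlap at least δ^{k/2} with signed copies of one unit vector, which forces a final value of at
least (1 + 2γl)^k δ^k (`le_progress_of_overlap`). Choosing γ with (1 + 2γl)δ = e yields T ≥ kδl/4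
(`le_of_pow_le_pow_mul`).

For the XOR lemma, an algorithm is run, the phase is flipped according to its output bit, and the
run is undone. An advantage c over guessing becomes overlap c in the phase at twice the number of
queries, whence 8 instead of 4. -/

/-! ### The progress function -/

/-- The value `Re ∑ M(x, y) ⟨φ_x, φ_y⟩` of the progress function with weight matrix `M` on a family
of vectors `φ_x`, given by their coordinates. -/
def progress {K S : Type*} [Fintype K] [Fintype S] (M : Matrix K K ℂ) (φ : K → S → ℂ) : ℝ :=
  (∑ x, ∑ y, M x y * ∑ s, star (φ x s) * φ y s).re

section Progress

variable {K S : Type*} [Fintype K] [Fintype S]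

theorem progress_add (M N : Matrix K K ℂ) (φ : K → S → ℂ) :
    progress (M + N) φ = progress M φ + progress N φ := by
  simp only [progress, Matrix.add_apply, add_mul, Finset.sum_add_distrib, Complex.add_re]

theorem progress_sub (M N : Matrix K K ℂ) (φ : K → S → ℂ) :
    progress (M - N) φ = progress M φ - progress N φ := by
  simp only [progress, Matrix.sub_apply, sub_mul, Finset.sum_sub_distrib, Complex.sub_re]

theorem progress_smul (c : ℝ) (M : Matrix K K ℂ) (φ : K → S → ℂ) :
    progress (c • M) φ = c * progress M φ := by
  simp only [progress, Matrix.smul_apply, smul_mul_assoc, ← Finset.smul_sum, Complex.smul_re,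
    smul_eq_mul]

theorem progress_eq_sum_quadratic (M : Matrix K K ℂ) (φ : K → S → ℂ) :
    progress M φ = ∑ s, (star (fun x => φ x s) ⬝ᵥ (M *ᵥ fun x => φ x s)).re := by
  rw [progress, ← Complex.re_sum]
  congr 1
  simp only [dotProduct, Matrix.mulVec, Finset.mul_sum, Pi.star_apply]
  calc _ = ∑ x, ∑ s, ∑ y, M x y * (star (φ x s) * φ y s) :=
        Finset.sum_congr rfl fun x _ => Finset.sum_comm
    _ = ∑ s, ∑ x, ∑ y, M x y * (star (φ x s) * φ y s) := Finset.sum_comm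
    _ = _ := by
        refine Finset.sum_congr rfl fun s _ => Finset.sum_congr rfl fun x _ =>
          Finset.sum_congr rfl fun y _ => ?_
        ring

theorem progress_nonneg {M : Matrix K K ℂ} (hM : M.PosSemidef) (φ : K → S → ℂ) :
    0 ≤ progress M φ := by
  rw [progress_eq_sum_quadratic]
  exact Finset.sum_nonneg fun s _ => hM.re_dotProduct_nonneg _

/-- Progress sees only the Gram matrix of the family, and only on the support of M; this is how
gates and the unaffected parts of a query drop out. -/
theorem progress_congr {M : Matrix K K ℂ} {φ φ' : K → S → ℂ}
    (h : ∀ x y, M x y ≠ 0 → ∑ s, star (φ x s) * φ y s = ∑ s, star (φ' x s) * φ' y s) :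
    progress M φ = progress M φ' := by
  unfold progress
  congr 1
  refine Finset.sum_congr rfl fun x _ => Finset.sum_congr rfl fun y _ => ?_
  by_cases hxy : M x y = 0
  · simp [hxy]
  · rw [h x y hxy]

theorem progress_fiberwise {O : Type*} [Fintype O] (M : Matrix K K ℂ) (φ : K → O × S → ℂ) :
    progress M φ = ∑ o, progress M (fun x s => φ x (o, s)) := by
  simp only [progress_eq_sum_quadratic, Fintype.sum_prod_type]

/-- A family of permutations of the coordinates which depends on `x` only through `a x` increases
the progress by at most a factor `1 + 2γ`. -/
theorem progress_comp_perm_le {Y : Type*} {M R E : Matrix K K ℂ} (a : K → Y) (γ : ℝ)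
    (hγ : 0 ≤ γ)
    (hM : ∀ x y, a x ≠ a y → M x y = E x y) (hR : ∀ x y, a x ≠ a y → R x y = 0)
    (hadd : (γ • R + E).PosSemidef) (hsub : (γ • R - E).PosSemidef)
    (hRM : (M - R).PosSemidef) (e : Y → Equiv.Perm S) (φ : K → S → ℂ) :
    progress M (fun x s => φ x (e (a x) s)) ≤ (1 + 2 * γ) * progress M φ := by
  set φ' : K → S → ℂ := fun x s => φ x (e (a x) s) with hφ'
  -- Inputs with the same value of `a` undergo the same permutation, so M - E and R, supported on
  -- such pairs, keep their progress.
  have hgram : ∀ x y, a x = a y →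
      ∑ s, star (φ' x s) * φ' y s = ∑ s, star (φ x s) * φ y s := by
    intro x y hxy
    simp only [hφ', hxy]
    exact Equiv.sum_comp (e (a y)) fun s => star (φ x s) * φ y s
  have h1 : progress (M - E) φ' = progress (M - E) φ := by
    refine progress_congr fun x y hxy => hgram x y ?_
    by_contra hne
    exact hxy (by rw [Matrix.sub_apply, hM x y hne, sub_self])
  have h2 : progress R φ' = progress R φ := by
    refine progress_congr fun x y hxy => hgram x y ?_
    by_contra hne
    exact hxy (hR x y hne)
  have h3 := progress_nonneg hsub φ'
  have h4 := progress_nonneg hadd φ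
  have h5 := progress_nonneg hRM φ
  rw [progress_sub, progress_sub] at h1
  rw [progress_sub, progress_smul, h2] at h3
  rw [progress_add, progress_smul] at h4
  rw [progress_sub] at h5
  -- Only E can change: its new value is at most γR and its old value at least -γR, so the gain is
  -- at most 2γR ≤ 2γM.
  nlinarith [mul_nonneg hγ h5]

/-- The Gram matrix of an eigenvector is a lower bound for a positive semidefinite matrix. -/
theorem Matrix.PosSemidef.sub_smul_vecMulVec_of_mulVec_eq {M : Matrix K K ℂ} (hM : M.PosSemidef)
    {w : K → ℂ} (hw : star w ⬝ᵥ w = 1) {μ : ℝ} (hMw : M *ᵥ w = μ • w) :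
    (M - μ • Matrix.vecMulVec w (star w)).PosSemidef := by
  classical
  set P := Matrix.vecMulVec w (star w) with hP
  have hPH : Pᴴ = P := by rw [hP, Matrix.conjTranspose_vecMulVec, star_star]
  have hMP : M * P = μ • P := by
    rw [hP, Matrix.mul_vecMulVec, hMw, Matrix.smul_vecMulVec]
  have hPM : P * M = μ • P := by
    have := congrArg Matrix.conjTranspose hMP
    simpa [Matrix.conjTranspose_mul, hPH, hM.isHermitian.eq] using this
  have hPP : P * P = P := by
    rw [hP, Matrix.vecMulVec_mul_vecMulVec, hw, one_smul]
  -- P is a spectral projection of M, so compressing M by 1 - P removes exactly μP.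
  have h := hM.conjTranspose_mul_mul_same (1 - P)
  have heq : (1 - P)ᴴ * M * (1 - P) = M - μ • P := by
    rw [Matrix.conjTranspose_sub, Matrix.conjTranspose_one, hPH]
    simp only [sub_mul, mul_sub, one_mul, mul_one, hPM, hMP, Matrix.smul_mul, hPP, sub_self,
      sub_zero]
  rwa [heq] at h

theorem progress_vecMulVec (w : K → ℂ) (φ : K → S → ℂ) :
    progress (Matrix.vecMulVec w (star w)) φ = ∑ s, ‖∑ x, star (w x) * φ x s‖ ^ 2 := by
  rw [progress_eq_sum_quadratic]
  refine Finset.sum_congr rfl fun s _ => ?_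
  have h : (star fun x => φ x s) ⬝ᵥ (Matrix.vecMulVec w (star w) *ᵥ fun x => φ x s) =
      star (∑ x, star (w x) * φ x s) * ∑ x, star (w x) * φ x s := by
    rw [Matrix.vecMulVec_mulVec, dotProduct_smul]
    simp only [dotProduct, Pi.star_apply, star_sum, star_mul', star_star, MulOpposite.smul_eq_mul_unop, MulOpposite.unop_op]
    congr 1
    exact Finset.sum_congr rfl fun x _ => mul_comm _ _
  rw [h, Complex.star_def, ← Complex.normSq_eq_conj_mul_self, Complex.ofReal_re,
    Complex.normSq_eq_norm_sq]

end Progress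

/-! ### Tensor powers -/

section Tensor

variable {X : Type*} {k : ℕ}

/-- The product of all tensor factors of `M^{⊗ k}` but the `p`-th one. -/
def tensorOthers (k : ℕ) (p : Fin k) (M : Matrix X X ℂ) : Matrix (Fin k → X) (Fin k → X) ℂ :=
  fun x y => ∏ q ∈ Finset.univ.erase p, M (x q) (y q)

/-- The matrix which is `N` on the `p`-th tensor factor and `M` on all the others. -/
def tensorReplace (k : ℕ) (p : Fin k) (M N : Matrix X X ℂ) :
    Matrix (Fin k → X) (Fin k → X) ℂ :=
  N.submatrix (fun x => x p) (fun x => x p) ⊙ tensorOthers k p M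

theorem tensorReplace_apply (p : Fin k) (M N : Matrix X X ℂ) (x y : Fin k → X) :
    tensorReplace k p M N x y = N (x p) (y p) * tensorOthers k p M x y := rfl

theorem tensorReplace_self (p : Fin k) (M : Matrix X X ℂ) :
    tensorReplace k p M M = tensorPower k M := by
  ext x y
  exact Finset.mul_prod_erase Finset.univ (fun q => M (x q) (y q)) (Finset.mem_univ p)

theorem tensorReplace_add (p : Fin k) (M N N' : Matrix X X ℂ) :
    tensorReplace k p M (N + N') = tensorReplace k p M N + tensorReplace k p M N' := by
  ext x y
  simp [tensorReplace_apply, add_mul]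

theorem tensorReplace_sub (p : Fin k) (M N N' : Matrix X X ℂ) :
    tensorReplace k p M (N - N') = tensorReplace k p M N - tensorReplace k p M N' := by
  ext x y
  simp [tensorReplace_apply, sub_mul]

theorem tensorReplace_smul (p : Fin k) (M N : Matrix X X ℂ) (c : ℝ) :
    tensorReplace k p M (c • N) = c • tensorReplace k p M N := by
  ext x y
  simp [tensorReplace_apply, mul_assoc]

theorem posSemidef_allOnes (Y : Type*) [Finite Y] : (allOnes Y).PosSemidef := by
  have := Fintype.ofFinite Y
  have h : allOnes Y = Matrix.vecMulVec (fun _ => 1) (star fun _ => 1) := by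
    ext; simp [allOnes, Matrix.vecMulVec_apply]
  rw [h]
  exact Matrix.posSemidef_vecMulVec_self_star _

/-- Schur product theorem: each factor is the pullback of M along a coordinate. Subsets are allowed
so that one factor can be left out and replaced. -/
theorem posSemidef_prod_apply [Finite X] {M : Matrix X X ℂ} (hM : M.PosSemidef)
    (s : Finset (Fin k)) :
    Matrix.PosSemidef (fun x y : Fin k → X => ∏ q ∈ s, M (x q) (y q)) := by
  induction s using Finset.induction_on with
  | empty =>
    have h : (fun x y : Fin k → X => ∏ q ∈ (∅ : Finset (Fin k)), M (x q) (y q)) =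
        allOnes (Fin k → X) := rfl
    exact h ▸ posSemidef_allOnes (Fin k → X)
  | insert q s hq ih =>
    have h : (fun x y : Fin k → X => ∏ q ∈ insert q s, M (x q) (y q)) =
        M.submatrix (fun x => x q) (fun x => x q) ⊙ fun x y => ∏ q ∈ s, M (x q) (y q) := by
      funext x y
      rw [Finset.prod_insert hq]
      rfl
    exact h ▸ (hM.submatrix fun x : Fin k → X => x q).hadamard ih

theorem Matrix.PosSemidef.tensorPower [Finite X] {M : Matrix X X ℂ} (hM : M.PosSemidef) (k : ℕ) :
    (tensorPower k M).PosSemidef :=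
  posSemidef_prod_apply hM Finset.univ

theorem Matrix.PosSemidef.tensorReplace [Finite X] {M N : Matrix X X ℂ} (hM : M.PosSemidef)
    (hN : N.PosSemidef) (p : Fin k) : (tensorReplace k p M N).PosSemidef :=
  (hN.submatrix fun x : Fin k → X => x p).hadamard (posSemidef_prod_apply hM _)

variable [Fintype X]

theorem sum_prod_apply_eq_prod_sum (g : Fin k → X → ℂ) :
    ∑ x : Fin k → X, ∏ p, g p (x p) = ∏ p, ∑ a, g p a := by
  classical
  rw [Finset.prod_univ_sum, Fintype.piFinset_univ]

theorem tensorPower_mulVec {M : Matrix X X ℂ} {v : X → ℂ} {μ : ℝ} (h : M *ᵥ v = μ • v) :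
    tensorPower k M *ᵥ (fun x => ∏ p, v (x p)) = (μ ^ k) • fun x : Fin k → X => ∏ p, v (x p) := by
  ext x
  have h' : ∀ a, ∑ b, M a b * v b = μ * v a := fun a => by
    have := congrFun h a
    simpa [Matrix.mulVec, dotProduct] using this
  simp only [Matrix.mulVec, dotProduct, tensorPower, ← Finset.prod_mul_distrib]
  rw [sum_prod_apply_eq_prod_sum (fun p b => M (x p) b * v b)]
  simp [h', Finset.prod_mul_distrib]

theorem star_dotProduct_prod_apply {v : X → ℂ} (h : star v ⬝ᵥ v = 1) :
    star (fun x : Fin k → X => ∏ p, v (x p)) ⬝ᵥ (fun x => ∏ p, v (x p)) = 1 := by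
  have h' : ∑ a, star (v a) * v a = 1 := h
  simp only [dotProduct, Pi.star_apply, star_prod, ← Finset.prod_mul_distrib]
  rw [sum_prod_apply_eq_prod_sum (fun _ a => star (v a) * v a)]
  simp only [h', Finset.prod_const_one]

end Tensor

/-! ### Extremal eigenvectors of Hermitian matrices -/

section Spectral

variable {X : Type*} [Fintype X] [DecidableEq X]

theorem Matrix.IsHermitian.posSemidef_norm_smul_one_sub {A : Matrix X X ℂ} (hA : A.IsHermitian) :
    (‖Matrix.toEuclideanCLM (𝕜 := ℂ) A‖ • (1 : Matrix X X ℂ) - A).PosSemidef := by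
  set c := ‖Matrix.toEuclideanCLM (𝕜 := ℂ) A‖ with hc
  have hH : (c • (1 : Matrix X X ℂ) - A).IsHermitian := by
    refine Matrix.IsHermitian.sub ?_ hA
    rw [Matrix.IsHermitian, Matrix.conjTranspose_smul, Matrix.conjTranspose_one, star_trivial]
  refine Matrix.PosSemidef.of_dotProduct_mulVec_nonneg hH fun v => ?_
  have him := hH.im_star_dotProduct_mulVec_self v
  rw [Complex.nonneg_iff]
  refine ⟨?_, him.symm⟩
  have h1 : (star v ⬝ᵥ (A *ᵥ v)).re ≤ c * ‖WithLp.toLp 2 v‖ ^ 2 := by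
    have h2 : star v ⬝ᵥ (A *ᵥ v) =
        inner ℂ (WithLp.toLp 2 v) (Matrix.toEuclideanCLM (𝕜 := ℂ) A (WithLp.toLp 2 v)) := by
      rw [EuclideanSpace.inner_eq_star_dotProduct, dotProduct_comm]
      rfl
    rw [h2]
    calc _ ≤ ‖inner ℂ (WithLp.toLp 2 v) (Matrix.toEuclideanCLM (𝕜 := ℂ) A (WithLp.toLp 2 v))‖ :=
          Complex.re_le_norm _
      _ ≤ ‖WithLp.toLp 2 v‖ * (c * ‖WithLp.toLp 2 v‖) :=
          (norm_inner_le_norm _ _).trans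
            (mul_le_mul_of_nonneg_left (ContinuousLinearMap.le_opNorm _ _) (norm_nonneg _))
      _ = _ := by ring
  have h3 : (star v ⬝ᵥ v).re = ‖WithLp.toLp 2 v‖ ^ 2 := by
    rw [← inner_self_eq_norm_sq (𝕜 := ℂ), EuclideanSpace.inner_eq_star_dotProduct,
      dotProduct_comm]
    rfl
  rw [Matrix.sub_mulVec, Matrix.smul_mulVec, Matrix.one_mulVec, dotProduct_sub, dotProduct_smul,
    Complex.sub_re, Complex.smul_re, h3, smul_eq_mul]
  linarith

/-- For a self-adjoint element of a C⋆-algebra the norm or its negative lies in the spectrum; in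
finite dimension spectral values are eigenvalues. -/
theorem Matrix.IsHermitian.exists_mulVec_eq_norm_smul [Nonempty X] {A : Matrix X X ℂ}
    (hA : A.IsHermitian) :
    ∃ v : X → ℂ, star v ⬝ᵥ v = 1 ∧
      (A *ᵥ v = ‖Matrix.toEuclideanCLM (𝕜 := ℂ) A‖ • v ∨
        A *ᵥ v = (-‖Matrix.toEuclideanCLM (𝕜 := ℂ) A‖) • v) := by
  set T := Matrix.toEuclideanCLM (𝕜 := ℂ) A with hT
  have hsa : IsSelfAdjoint T := by
    have : IsSelfAdjoint A := hA
    exact this.map _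
  have key : ∀ c : ℝ, c ∈ spectrum ℝ T → ∃ v : X → ℂ, star v ⬝ᵥ v = 1 ∧ A *ᵥ v = c • v := by
    intro c hc
    have h1 : (c : ℂ) ∈ spectrum ℂ T := by
      rw [← spectrum.algebraMap_mem_iff ℂ (R := ℝ)] at hc
      exact hc
    have h2 : (c : ℂ) ∈ spectrum ℂ (Matrix.toLin' A) := by
      rw [Matrix.spectrum_toLin', ← AlgEquiv.spectrum_eq (Matrix.toEuclideanCLM (n := X) (𝕜 := ℂ))]
      exact h1
    obtain ⟨u, hu⟩ := (Module.End.hasEigenvalue_iff_mem_spectrum.mpr h2).exists_hasEigenvector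
    have hu1 : A *ᵥ u = (c : ℂ) • u := by simpa using hu.apply_eq_smul
    have hpos : 0 < ‖WithLp.toLp 2 u‖ := by
      rw [norm_pos_iff]
      intro h0
      exact hu.2 (by simpa using congrArg WithLp.ofLp h0)
    have h3 : star u ⬝ᵥ u = ((‖WithLp.toLp 2 u‖ ^ 2 : ℝ) : ℂ) := by
      have := inner_self_eq_norm_sq_to_K (𝕜 := ℂ) (WithLp.toLp 2 u)
      rw [EuclideanSpace.inner_eq_star_dotProduct, dotProduct_comm] at this
      rw [this]
      push_cast
      rfl
    refine ⟨(‖WithLp.toLp 2 u‖⁻¹ : ℝ) • u, ?_, ?_⟩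
    · rw [star_smul, smul_dotProduct, dotProduct_smul, h3, star_trivial]
      simp only [Complex.real_smul]
      rw [← Complex.ofReal_mul, ← Complex.ofReal_mul, ← Complex.ofReal_one]
      congr 1
      field_simp
    · rw [Matrix.mulVec_smul, hu1, smul_comm]
      rfl
  rcases CStarAlgebra.norm_or_neg_norm_mem_spectrum hsa with h | h
  · obtain ⟨v, h1, h2⟩ := key _ h
    exact ⟨v, h1, Or.inl h2⟩
  · obtain ⟨v, h1, h2⟩ := key _ h
    exact ⟨v, h1, Or.inr h2⟩

end Spectral

/-! ### Progress of a query algorithm -/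

section Algorithm

variable {K ι D G : Type*} [Fintype K] [Fintype ι] [Fintype G] [AddCommGroup G]

/-- The hypotheses on a weight matrix `M` under which one query increases the progress by at most
a factor `1 + 2γ`: for every position `i`, the matrix `M` splits into a part supported on pairs of
inputs which agree at `i` and a part between `± γ R` with `R ⪯ M` supported on such pairs. -/
def QueryBounded (str : K → ι → D) (M : Matrix K K ℂ) (γ : ℝ) : Prop :=
  ∀ i, ∃ R E : Matrix K K ℂ,
    (∀ x y, str x i ≠ str y i → M x y = E x y) ∧ (∀ x y, str x i ≠ str y i → R x y = 0) ∧
    (γ • R + E).PosSemidef ∧ (γ • R - E).PosSemidef ∧ (M - R).PosSemidef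

theorem oracle_apply (m : ℕ) (z : ι → G) (ψ : StateSpace ι G m) (s : BasisState ι G m) :
    oracle m z ψ s = ψ (s.1, s.2.1 - s.1.elim 0 z, s.2.2) := rfl

theorem sum_star_mul_eq_inner {S : Type*} [Fintype S] (ψ φ : EuclideanSpace ℂ S) :
    ∑ s, star (ψ s) * φ s = inner ℂ ψ φ := by
  rw [EuclideanSpace.inner_eq_star_dotProduct, dotProduct_comm]
  rfl

theorem progress_gate {S : Type*} [Fintype S] (M : Matrix K K ℂ)
    (U : EuclideanSpace ℂ S ≃ₗᵢ[ℂ] EuclideanSpace ℂ S) (ψ : K → EuclideanSpace ℂ S) :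
    progress M (fun x s => U (ψ x) s) = progress M (fun x s => ψ x s) := by
  refine progress_congr fun x y _ => ?_
  rw [sum_star_mul_eq_inner, sum_star_mul_eq_inner, LinearIsometryEquiv.inner_map_map]

/-- The oracle preserves the query register, so progress splits over its values; on the block of
index i it permutes coordinates in a way depending on x only through its symbol at i. -/
theorem progress_oracle_le (enc : D → G) {str : K → ι → D} {M : Matrix K K ℂ} {γ : ℝ}
    (hγ : 0 ≤ γ) (hM : M.PosSemidef) (h : QueryBounded str M γ) (m : ℕ)
    (ψ : K → StateSpace ι G m) :
    progress M (fun x s => oracle m (fun i => enc (str x i)) (ψ x) s) ≤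
      (1 + 2 * γ) * progress M (fun x s => ψ x s) := by
  rw [progress_fiberwise, progress_fiberwise, Finset.mul_sum]
  refine Finset.sum_le_sum fun o _ => ?_
  cases o with
  | none =>
    simp only [oracle_apply, Option.elim_none, sub_zero]
    nlinarith [progress_nonneg hM fun x (s : G × Fin (m + 1)) => ψ x (none, s)]
  | some i =>
    obtain ⟨R, E, hME, hR, hadd, hsub, hRM⟩ := h i
    exact progress_comp_perm_le (fun x => str x i) γ hγ hME hR hadd hsub hRM
      (fun d => (Equiv.subRight (enc d)).prodCongr (Equiv.refl (Fin (m + 1))))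
      (fun x s => ψ x (some i, s))

theorem progress_state_le (enc : D → G) {str : K → ι → D} {M : Matrix K K ℂ} {γ : ℝ}
    (hγ : 0 ≤ γ) (hM : M.PosSemidef) (h : QueryBounded str M γ) (A : QueryAlgorithm ι G)
    (v : K → ℂ) (T : ℕ) :
    progress M (fun x s => (v x • A.state (fun i => enc (str x i)) T) s) ≤
      (1 + 2 * γ) ^ T * (star v ⬝ᵥ (M *ᵥ v)).re := by
  classical
  induction T with
  | zero =>
    have h1 := progress_gate M (A.gate 0)
      (fun x => v x • EuclideanSpace.single ((none, 0, 0) : BasisState ι G A.workSize) (1 : ℂ))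
    simp only [map_smul] at h1
    refine le_of_eq ?_
    simp only [QueryAlgorithm.state]
    convert h1 using 1
    -- All inputs start in the same basis state, so only that coordinate contributes, with the
    -- quadratic form of M at v.
    rw [pow_zero, one_mul, progress_eq_sum_quadratic,
      Finset.sum_eq_single ((none, 0, 0) : BasisState ι G A.workSize)]
    · simp
    · intro s _ hs
      simp [hs, Matrix.mulVec, dotProduct]
    · simp
  | succ T ih =>
    have h1 := progress_gate M (A.gate (T + 1)) fun x =>
      oracle A.workSize (fun i => enc (str x i)) (v x • A.state (fun i => enc (str x i)) T)
    have h2 := progress_oracle_le enc hγ hM h A.workSize fun x =>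
      v x • A.state (fun i => enc (str x i)) T
    have h3 : progress M (fun x s => (v x • A.state (fun i => enc (str x i)) (T + 1)) s) ≤
        (1 + 2 * γ) * progress M (fun x s => (v x • A.state (fun i => enc (str x i)) T) s) := by
      rw [← h1] at h2
      simp only [map_smul] at h2
      exact h2
    calc _ ≤ _ := h3
      _ ≤ (1 + 2 * γ) * ((1 + 2 * γ) ^ T * (star v ⬝ᵥ (M *ᵥ v)).re) :=
          mul_le_mul_of_nonneg_left ih (by positivity)
      _ = _ := by ring

/-- If the final states have overlap at least `c` with signed copies of a fixed unit vector, the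
progress is at least `μ c²` for every eigenvalue `μ` of `M` whose eigenvector is the signed
initial vector. -/
theorem le_progress_of_overlap {S : Type*} [Fintype S] {M : Matrix K K ℂ} (hM : M.PosSemidef)
    {v w : K → ℂ} {μ : ℝ} (sgn : K → ℝ) (hv : star v ⬝ᵥ v = 1) (hw : star w ⬝ᵥ w = 1)
    (hwv : ∀ x, w x = sgn x * v x) (hμ : 0 ≤ μ) (hMw : M *ᵥ w = μ • w)
    (ψ : K → EuclideanSpace ℂ S) (τ : EuclideanSpace ℂ S) (hτ : ‖τ‖ ≤ 1) {c : ℝ} (hc : 0 ≤ c)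
    (h : ∀ x, c ≤ (inner ℂ (ψ x) (sgn x • τ)).re) :
    μ * c ^ 2 ≤ progress M (fun x s => (v x • ψ x) s) := by
  have h1 := progress_nonneg (hM.sub_smul_vecMulVec_of_mulVec_eq hw hMw)
    fun x s => (v x • ψ x) s
  rw [progress_sub, progress_smul, progress_vecMulVec] at h1
  set Φ : EuclideanSpace ℂ S := ∑ x, star (w x) • v x • ψ x with hΦ
  have h2 : ∑ s, ‖∑ x, star (w x) * (v x • ψ x) s‖ ^ 2 = ‖Φ‖ ^ 2 := by
    rw [EuclideanSpace.norm_sq_eq]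
    refine Finset.sum_congr rfl fun s _ => ?_
    simp [hΦ]
  have hv' : ∑ x, ‖v x‖ ^ 2 = 1 := by
    have := congrArg Complex.re hv
    simpa [dotProduct, ← Complex.normSq_eq_conj_mul_self, Complex.normSq_eq_norm_sq,
      Complex.ofReal_re, ← Complex.ofReal_pow] using this
  -- The coefficient of ψ x in Φ is sgn x · |v x|², so this overlap is the average, with weights |v
  -- x|², of the assumed overlaps.
  have h3 : c ≤ (inner ℂ Φ τ).re := by
    have : (inner ℂ Φ τ).re = ∑ x, ‖v x‖ ^ 2 * (inner ℂ (ψ x) (sgn x • τ)).re := by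
      rw [hΦ, sum_inner, Complex.re_sum]
      refine Finset.sum_congr rfl fun x _ => ?_
      rw [← Complex.coe_smul (sgn x) τ, inner_smul_left, inner_smul_left, inner_smul_right, hwv,
        ← Complex.re_ofReal_mul]
      congr 1
      rw [← Complex.normSq_eq_norm_sq, Complex.normSq_eq_conj_mul_self]
      simp
      ring
    rw [this]
    calc c = ∑ x, ‖v x‖ ^ 2 * c := by rw [← Finset.sum_mul, hv', one_mul]
      _ ≤ _ := Finset.sum_le_sum fun x _ => mul_le_mul_of_nonneg_left (h x) (sq_nonneg _)
  have h4 : c ≤ ‖Φ‖ := by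
    calc c ≤ ‖inner ℂ Φ τ‖ := h3.trans (Complex.re_le_norm _)
      _ ≤ ‖Φ‖ * ‖τ‖ := norm_inner_le_norm _ _
      _ ≤ ‖Φ‖ := mul_le_of_le_one_right (norm_nonneg _) hτ
  rw [h2] at h1
  have h5 : c ^ 2 ≤ ‖Φ‖ ^ 2 := pow_le_pow_left₀ hc h4 2
  nlinarith [mul_le_mul_of_nonneg_left h5 hμ]

end Algorithm

/-! ### From additive to multiplicative adversary matrices -/

section Adversary

variable {X ι D : Type*}

/-- The sign `(-1)^{f(x)}`. -/
def phaseSign (f : X → ZMod 2) (x : X) : ℝ := (-1) ^ (f x).val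

theorem phaseSign_mul_self (f : X → ZMod 2) (x : X) : phaseSign f x * phaseSign f x = 1 := by
  rw [phaseSign, ← mul_pow]
  norm_num

theorem phaseSign_mul_phaseSign (f : X → ZMod 2) (x y : X) :
    phaseSign f x * phaseSign f y = if f x = f y then 1 else -1 := by
  have key : ∀ a b : ZMod 2, ((-1 : ℤ) ^ a.val * (-1) ^ b.val) = if a = b then 1 else -1 := by
    decide
  have := congrArg (Int.cast : ℤ → ℝ) (key (f x) (f y))
  push_cast at this
  exact this

theorem allOnes_sub_functionGram_apply (f : X → ZMod 2) (x y : X) :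
    (allOnes X - functionGram f) x y = (1 - (phaseSign f x : ℂ) * phaseSign f y) / 2 := by
  rw [← Complex.ofReal_mul, phaseSign_mul_phaseSign, Matrix.sub_apply, allOnes, functionGram]
  split_ifs <;> norm_num

variable [Fintype X]

/-- The matrix vanishes between inputs of equal value, so conjugation by the signs negates it and
its spectrum is symmetric. -/
theorem hadamard_functionGram_mulVec_sign (Γ : Matrix X X ℂ) (f : X → ZMod 2) {v : X → ℂ} {c : ℝ}
    (h : (Γ ⊙ (allOnes X - functionGram f)) *ᵥ v = c • v) :
    (Γ ⊙ (allOnes X - functionGram f)) *ᵥ (fun x => phaseSign f x * v x) =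
      (-c) • fun x => phaseSign f x * v x := by
  ext x
  have hx := congrFun h x
  simp only [Matrix.mulVec, dotProduct, Matrix.hadamard_apply, allOnes_sub_functionGram_apply,
    Pi.smul_apply, Complex.real_smul] at hx ⊢
  have hs : ∀ z, (phaseSign f z : ℂ) * phaseSign f z = 1 := fun z => by
    rw [← Complex.ofReal_mul, phaseSign_mul_self, Complex.ofReal_one]
  calc _ = ∑ y, -(phaseSign f x : ℂ) *
        (Γ x y * ((1 - (phaseSign f x : ℂ) * phaseSign f y) / 2) * v y) := by
        refine Finset.sum_congr rfl fun y _ => ?_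
        linear_combination (-(1 / 2) * Γ x y * v y * phaseSign f x) * hs y
          + (-(1 / 2) * Γ x y * v y * phaseSign f y) * hs x
    _ = _ := by
        rw [← Finset.mul_sum, hx]
        push_cast
        ring

theorem star_dotProduct_sign_mul (f : X → ZMod 2) (v : X → ℂ) :
    star (fun x => (phaseSign f x : ℂ) * v x) ⬝ᵥ (fun x => phaseSign f x * v x) =
      star v ⬝ᵥ v := by
  refine Finset.sum_congr rfl fun x _ => ?_
  have hs : (phaseSign f x : ℂ) * phaseSign f x = 1 := by
    rw [← Complex.ofReal_mul, phaseSign_mul_self, Complex.ofReal_one]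
  simp only [Pi.star_apply, star_mul', Complex.star_def, Complex.conj_ofReal]
  linear_combination (starRingEnd ℂ (v x) * v x) * hs

variable [DecidableEq X] [DecidableEq D]

/-- The constraints on `Γ` in the additive adversary bound. -/
def IsAdversaryMatrix (str : X → ι → D) (Γ : Matrix X X ℂ) : Prop :=
  Γ.IsHermitian ∧ ∀ i : ι,
    (1 + Γ ⊙ (allOnes X - agreeMatrix str i)).PosSemidef ∧
    (1 - Γ ⊙ (allOnes X - agreeMatrix str i)).PosSemidef

/-- Here P = (M + SNS)/2 with S the diagonal sign matrix. For M = 1 ± B and N = 1 ∓ B this is 1 ± B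
∘ (J - F), as J - F has entries (1 - s_x s_y)/2. -/
theorem Matrix.PosSemidef.average_conj_sign {M N P : Matrix X X ℂ} (hM : M.PosSemidef)
    (hN : N.PosSemidef) (f : X → ZMod 2)
    (hP : ∀ x y, P x y = (M x y + (phaseSign f x : ℂ) * phaseSign f y * N x y) / 2) :
    P.PosSemidef := by
  have h := (hM.add (hN.mul_mul_conjTranspose_same
    (Matrix.diagonal fun x => (phaseSign f x : ℂ)))).smul (show (0 : ℝ) ≤ 1 / 2 by norm_num)
  have heq : P = (1 / 2 : ℝ) • (M + Matrix.diagonal (fun x => (phaseSign f x : ℂ)) * N *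
      (Matrix.diagonal fun x => (phaseSign f x : ℂ))ᴴ) := by
    ext x y
    rw [hP]
    simp [Matrix.diagonal_conjTranspose, Matrix.mul_diagonal, Matrix.diagonal_mul]
    ring
  rwa [heq]

/-- Removing the entries of an adversary matrix on pairs with equal function value keeps the
constraints. -/
theorem IsAdversaryMatrix.hadamard_functionGram {str : X → ι → D} {Γ : Matrix X X ℂ}
    (h : IsAdversaryMatrix str Γ) (f : X → ZMod 2) :
    IsAdversaryMatrix str (Γ ⊙ (allOnes X - functionGram f)) := by
  have hone : ∀ x y, (phaseSign f x : ℂ) * phaseSign f y * (1 : Matrix X X ℂ) x y =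
      (1 : Matrix X X ℂ) x y := by
    intro x y
    by_cases hxy : x = y
    · subst hxy
      rw [← Complex.ofReal_mul, phaseSign_mul_self, Complex.ofReal_one, one_mul]
    · simp [hxy]
  refine ⟨h.1.hadamard ?_, fun i => ⟨?_, ?_⟩⟩
  · ext x y
    rw [Matrix.conjTranspose_apply, allOnes_sub_functionGram_apply,
      allOnes_sub_functionGram_apply, mul_comm]
    simp
  · refine (h.2 i).1.average_conj_sign (h.2 i).2 f fun x y => ?_
    have := hone x y
    simp only [Matrix.add_apply, Matrix.sub_apply (1 : Matrix X X ℂ), Matrix.hadamard_apply,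
      allOnes_sub_functionGram_apply] at this ⊢
    linear_combination -(1 / 2) * this
  · refine (h.2 i).2.average_conj_sign (h.2 i).1 f fun x y => ?_
    have := hone x y
    simp only [Matrix.add_apply, Matrix.sub_apply (1 : Matrix X X ℂ), Matrix.hadamard_apply,
      allOnes_sub_functionGram_apply] at this ⊢
    linear_combination -(1 / 2) * this

/-- The norm of the bipartite part of an adversary matrix is one of its eigenvalues. -/
theorem exists_norm_eigenvector [Nonempty X] {Γ : Matrix X X ℂ} (f : X → ZMod 2)
    (h : (Γ ⊙ (allOnes X - functionGram f)).IsHermitian) :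
    ∃ v : X → ℂ, star v ⬝ᵥ v = 1 ∧
      (Γ ⊙ (allOnes X - functionGram f)) *ᵥ v =
        ‖Matrix.toEuclideanCLM (𝕜 := ℂ) (Γ ⊙ (allOnes X - functionGram f))‖ • v := by
  obtain ⟨v, hv, hA | hA⟩ := h.exists_mulVec_eq_norm_smul
  · exact ⟨v, hv, hA⟩
  · refine ⟨fun x => phaseSign f x * v x, (star_dotProduct_sign_mul f v).trans hv, ?_⟩
    simpa using hadamard_functionGram_mulVec_sign Γ f hA

/-- Tensor powers of the multiplicative adversary matrix `1 + γ (c - A)` grow by at most a factor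
`1 + 2γ` per query. -/
theorem IsAdversaryMatrix.queryBounded_tensorPower {str : X → ι → D} {A : Matrix X X ℂ}
    (h : IsAdversaryMatrix str A) {c γ : ℝ} (hγ : 0 ≤ γ)
    (hc : (c • (1 : Matrix X X ℂ) - A).PosSemidef) (k : ℕ) :
    QueryBounded (tupleString k str) (tensorPower k (1 + γ • (c • (1 : Matrix X X ℂ) - A))) γ := by
  rintro ⟨p, j⟩
  have hone : (1 : Matrix X X ℂ).PosSemidef := Matrix.PosSemidef.one
  have hM : (1 + γ • (c • (1 : Matrix X X ℂ) - A)).PosSemidef := hone.add (hc.smul hγ)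
  set M := 1 + γ • (c • (1 : Matrix X X ℂ) - A) with hMdef
  -- In copy p, R has the identity and E the part of -γA on pairs differing at j. The constraint at
  -- j places E between ±γR, and M - 1 = γ(c - A) ⪰ 0 gives R ⪯ M^{⊗k}.
  refine ⟨tensorReplace k p M 1,
    tensorReplace k p M ((-γ) • (A ⊙ (allOnes X - agreeMatrix str j))), ?_, ?_, ?_, ?_, ?_⟩
  · intro x y hxy
    have hxy' : str (x p) j ≠ str (y p) j := hxy
    have hne : x p ≠ y p := fun h0 => hxy' (by rw [h0])
    rw [← tensorReplace_self p, tensorReplace_apply, tensorReplace_apply]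
    congr 1
    simp [hMdef, hne, allOnes, agreeMatrix, hxy']
  · intro x y hxy
    have hne : x p ≠ y p := fun h0 => hxy (by simp only [tupleString, h0])
    rw [tensorReplace_apply, Matrix.one_apply_ne hne, zero_mul]
  · rw [← tensorReplace_smul, ← tensorReplace_add]
    refine hM.tensorReplace ?_ p
    rw [neg_smul, ← sub_eq_add_neg, ← smul_sub]
    exact (h.2 j).2.smul hγ
  · rw [← tensorReplace_smul, ← tensorReplace_sub]
    refine hM.tensorReplace ?_ p
    rw [neg_smul, sub_neg_eq_add, ← smul_add]
    exact (h.2 j).1.smul hγ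
  · rw [← tensorReplace_self p M, ← tensorReplace_sub]
    refine hM.tensorReplace ?_ p
    rw [hMdef, add_sub_cancel_left]
    exact hc.smul hγ

end Adversary

/-! ### The strong direct product theorem -/

/-- Vectors whose Gram matrix is `s_x s_y` with signs `s_x` are signed copies of a unit vector. -/
theorem exists_eq_sign_smul {K H : Type*} [Nonempty K] [NormedAddCommGroup H]
    [InnerProductSpace ℂ H] {s : K → ℝ} (hs : ∀ x, s x * s x = 1) {τ : K → H}
    (h : ∀ x y, inner ℂ (τ x) (τ y) = (s x : ℂ) * s y) :
    ∃ τ₀ : H, ‖τ₀‖ = 1 ∧ ∀ x, τ x = s x • τ₀ := by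
  obtain ⟨x₀⟩ := ‹Nonempty K›
  have hs' : ∀ x, (s x : ℂ) * s x = 1 := fun x => by
    rw [← Complex.ofReal_mul, hs, Complex.ofReal_one]
  refine ⟨(s x₀ : ℂ) • τ x₀, ?_, fun x => ?_⟩
  · have h1 : inner ℂ ((s x₀ : ℂ) • τ x₀) ((s x₀ : ℂ) • τ x₀) = (1 : ℂ) := by
      rw [inner_smul_left, inner_smul_right, h, Complex.conj_ofReal]
      linear_combination (s x₀ * s x₀ + 1 : ℂ) * hs' x₀
    have h2 := inner_self_eq_norm_sq_to_K (𝕜 := ℂ) ((s x₀ : ℂ) • τ x₀)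
    rw [h1] at h2
    have h3 : ‖(s x₀ : ℂ) • τ x₀‖ ^ 2 = 1 :=
      Complex.ofReal_injective (by rw [Complex.ofReal_pow, Complex.ofReal_one]; exact h2.symm)
    exact (pow_eq_one_iff_of_nonneg (norm_nonneg _) two_ne_zero).mp h3
  · rw [← Complex.coe_smul, smul_smul, ← sub_eq_zero, ← inner_self_eq_zero (𝕜 := ℂ)]
    simp only [inner_sub_left, inner_sub_right, inner_smul_left, inner_smul_right, h, map_mul,
      Complex.conj_ofReal]
    linear_combination (1 - 2 * (s x₀ * s x₀) + s x₀ * s x₀ * (s x₀ * s x₀) : ℂ) * hs' x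
      + (s x₀ * s x₀ - 1 : ℂ) * hs' x₀

theorem le_of_pow_le_pow_mul {l δ : ℝ} (hl : 0 < l) (hδ : 0 < δ) (hδ1 : δ ≤ 1) {k T : ℕ}
    (h : ∀ γ : ℝ, 0 ≤ γ → (1 + 2 * γ * l) ^ k * δ ^ k ≤ (1 + 2 * γ) ^ T) :
    k * δ / 4 * l ≤ T := by
  have he1 : 1 ≤ Real.exp 1 := Real.one_le_exp zero_le_one
  have he4 : Real.exp 1 ≤ 4 := Real.exp_one_lt_d9.le.trans (by norm_num)
  -- Chosen so that (1 + 2γl)δ = e. Then e^k ≤ (1 + 2γ)^T ≤ e^{2γT}, and 2γlδ = e - δ ≤ 4 supplies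
  -- the constant 4.
  set γ := (Real.exp 1 / δ - 1) / (2 * l) with hγ
  have hγ0 : 0 ≤ γ := by
    refine div_nonneg ?_ (by positivity)
    rw [sub_nonneg, le_div_iff₀ hδ]
    linarith
  have h1 : (1 + 2 * γ * l) * δ = Real.exp 1 := by
    rw [hγ]
    field_simp
    ring
  have h2 := h γ hγ0
  rw [← mul_pow, h1, ← Real.exp_nat_mul, mul_one] at h2
  have h3 : (1 + 2 * γ) ^ T ≤ Real.exp (T * (2 * γ)) := by
    rw [Real.exp_nat_mul]
    exact pow_le_pow_left₀ (by positivity) (by linarith [Real.add_one_le_exp (2 * γ)]) T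
  have h4 : (k : ℝ) ≤ T * (2 * γ) := Real.exp_le_exp.mp (h2.trans h3)
  have h5 : 2 * γ * (l * δ) ≤ 4 := by nlinarith
  have hT : (0 : ℝ) ≤ T := T.cast_nonneg
  have h6 := mul_le_mul_of_nonneg_right h4 (mul_pos hl hδ).le
  have h7 := mul_le_mul_of_nonneg_left h5 hT
  nlinarith

theorem tensorPower_phaseGram_apply {X : Type*} (k : ℕ) (f : X → ZMod 2) (x y : Fin k → X) :
    tensorPower k (phaseGram f) x y =
      ((∏ p, phaseSign f (x p) : ℝ) : ℂ) * (∏ p, phaseSign f (y p) : ℝ) := by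
  simp only [tensorPower, phaseGram, phaseSign, pow_add, Finset.prod_mul_distrib]
  push_cast
  rfl

theorem GeneratesCoherently.le_queries {X ι D G : Type*} [Fintype X] [DecidableEq X]
    [Fintype ι] [DecidableEq D] [Fintype G] [AddCommGroup G] {enc : D ↪ G} {str : X → ι → D}
    {f : X → ZMod 2} {δ : ℝ} (hδ0 : 0 ≤ δ) (hδ1 : δ ≤ 1) {k T : ℕ}
    (h : GeneratesCoherently enc (tupleString k str) (tensorPower k (phaseGram f)) (1 - δ ^ k) T)
    {Γ : Matrix X X ℂ} (hΓ : IsAdversaryMatrix str Γ) :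
    k * δ / 4 * ‖Matrix.toEuclideanCLM (𝕜 := ℂ) (Γ ⊙ (allOnes X - functionGram f))‖ ≤ T := by
  have hA := hΓ.hadamard_functionGram f
  have hc := hA.1.posSemidef_norm_smul_one_sub
  have hsign := fun v c => hadamard_functionGram_mulVec_sign Γ f (v := v) (c := c)
  have hex := fun _ : Nonempty X => exists_norm_eigenvector f hA.1
  set A := Γ ⊙ (allOnes X - functionGram f)
  set l := ‖Matrix.toEuclideanCLM (𝕜 := ℂ) A‖ with hl
  rcases hδ0.eq_or_lt with rfl | hδ
  · simp
  -- The choice of γ divides by δ and by l; the bound is trivial when either is zero.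
  rcases (norm_nonneg (Matrix.toEuclideanCLM (𝕜 := ℂ) A)).eq_or_lt with h0 | hlpos
  · rw [hl, ← h0, mul_zero]
    exact T.cast_nonneg
  have hX : Nonempty X := by
    by_contra hX
    rw [not_nonempty_iff] at hX
    have : A = 0 := Subsingleton.elim _ _
    rw [this, map_zero, norm_zero] at hlpos
    exact lt_irrefl _ hlpos
  obtain ⟨v, hv, hAv⟩ := hex hX
  refine le_of_pow_le_pow_mul hlpos hδ hδ1 fun γ hγ => ?_
  set M := 1 + γ • (l • (1 : Matrix X X ℂ) - A) with hM
  have hMpos : M.PosSemidef := Matrix.PosSemidef.one.add (hc.smul hγ)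
  have hmul : ∀ (u : X → ℂ) (c : ℝ), A *ᵥ u = c • u → M *ᵥ u = (1 + γ * (l - c)) • u := by
    intro u c hu
    rw [hM, Matrix.add_mulVec, Matrix.smul_mulVec, Matrix.sub_mulVec, Matrix.smul_mulVec,
      Matrix.one_mulVec, hu, ← sub_smul, smul_smul, add_smul, one_smul]
  set w : X → ℂ := fun x => phaseSign f x * v x with hw
  have hMv : M *ᵥ v = (1 : ℝ) • v := by simpa using hmul v l hAv
  have hMw : M *ᵥ w = (1 + 2 * γ * l) • w := by
    rw [hmul w (-l) (hsign v l hAv)]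
    congr 1
    ring
  obtain ⟨Alg, τ, hτ, hov⟩ := h
  obtain ⟨τ₀, hτ₀, hτx⟩ := exists_eq_sign_smul (s := fun x : Fin k → X => ∏ p, phaseSign f (x p))
    (fun x => by simp only [← Finset.prod_mul_distrib, phaseSign_mul_self, Finset.prod_const_one])
    (fun x y => (hτ x y).trans (tensorPower_phaseGram_apply k f x y))
  have hup := progress_state_le enc hγ (hMpos.tensorPower k)
    (hA.queryBounded_tensorPower hγ hc k) Alg (fun x => ∏ p, v (x p)) T
  rw [tensorPower_mulVec hMv, one_pow, one_smul, star_dotProduct_prod_apply hv, Complex.one_re,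
    mul_one] at hup
  have hlow := le_progress_of_overlap (hMpos.tensorPower k)
    (v := fun x => ∏ p, v (x p)) (w := fun x => ∏ p, w (x p))
    (fun x => ∏ p, phaseSign f (x p)) (star_dotProduct_prod_apply hv)
    (star_dotProduct_prod_apply ((star_dotProduct_sign_mul f v).trans hv))
    (fun x => by simp only [hw, Finset.prod_mul_distrib, Complex.ofReal_prod])
    (by positivity) (tensorPower_mulVec hMw)
    (fun x => Alg.state (fun i => enc (tupleString k str x i)) T) τ₀ hτ₀.le
    (Real.sqrt_nonneg (1 - (1 - δ ^ k))) (fun x => by rw [← hτx x]; exact hov x)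
  -- The squared overlap threshold is 1 - (1 - δ^k) = δ^k.
  rw [sub_sub_cancel, Real.sq_sqrt (by positivity)] at hlow
  exact hlow.trans hup

/-! ### From computing a bit to computing it in the phase -/

section Uncompute

variable {ι G : Type*} [Fintype ι] [Fintype G] [AddCommGroup G]

/-- The unitary `|i, b, w⟩ ↦ |i, -b, w⟩`. -/
noncomputable def negateAnswer (ι G : Type*) [Fintype ι] [Fintype G] [AddCommGroup G] (m : ℕ) :
    StateSpace ι G m ≃ₗᵢ[ℂ] StateSpace ι G m :=
  LinearIsometryEquiv.piLpCongrLeft 2 ℂ ℂ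
    ((Equiv.refl (Option ι)).prodCongr ((Equiv.neg G).prodCongr (Equiv.refl (Fin (m + 1)))))

theorem negateAnswer_apply (m : ℕ) (ψ : StateSpace ι G m) (s : BasisState ι G m) :
    negateAnswer ι G m ψ s = ψ (s.1, -s.2.1, s.2.2) := rfl

theorem negateAnswer_oracle_negateAnswer_oracle (m : ℕ) (z : ι → G) (ψ : StateSpace ι G m) :
    negateAnswer ι G m (oracle m z (negateAnswer ι G m (oracle m z ψ))) = ψ := by
  ext s
  rw [negateAnswer_apply, oracle_apply, negateAnswer_apply, oracle_apply]
  simp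

/-- The diagonal unitary `|s⟩ ↦ (-1)^{out(s)} |s⟩`. -/
noncomputable def phaseFlip {S : Type*} [Fintype S] (out : S → ZMod 2) :
    EuclideanSpace ℂ S ≃ₗᵢ[ℂ] EuclideanSpace ℂ S :=
  LinearIsometryEquiv.piLpCongrRight 2 fun s =>
    if out s = 0 then LinearIsometryEquiv.refl ℂ ℂ else LinearIsometryEquiv.neg ℂ

theorem phaseFlip_apply {S : Type*} [Fintype S] (out : S → ZMod 2) (ψ : EuclideanSpace ℂ S)
    (s : S) : phaseFlip out ψ s = phaseSign out s * ψ s := by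
  have h1 : phaseFlip out ψ s = (if out s = 0 then LinearIsometryEquiv.refl ℂ ℂ
      else LinearIsometryEquiv.neg ℂ) (ψ s) := rfl
  rw [h1, phaseSign]
  have h2 : out s = 0 ∨ out s = 1 := by
    generalize out s = a
    revert a
    decide
  rcases h2 with h | h
  · simp [h]
  · simp [h, ZMod.val_one]

/-- The gates of the algorithm which runs `A` with `T` queries, applies `V`, and runs `A` backwards.
The inverse oracle is obtained from the oracle by negating the answer register before and after. -/
noncomputable def QueryAlgorithm.uncomputeGate (A : QueryAlgorithm ι G)
    (V : StateSpace ι G A.workSize ≃ₗᵢ[ℂ] StateSpace ι G A.workSize) (T t : ℕ) :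
    StateSpace ι G A.workSize ≃ₗᵢ[ℂ] StateSpace ι G A.workSize :=
  if t < T then A.gate t
  else if t = T then
    (((A.gate T).trans V).trans (A.gate T).symm).trans (negateAnswer ι G A.workSize)
  else ((negateAnswer ι G A.workSize).trans (A.gate (2 * T - t)).symm).trans
    (negateAnswer ι G A.workSize)

/-- The algorithm which runs `A` with `T` queries, applies `V`, and runs `A` backwards. -/
noncomputable def QueryAlgorithm.uncompute (A : QueryAlgorithm ι G)
    (V : StateSpace ι G A.workSize ≃ₗᵢ[ℂ] StateSpace ι G A.workSize) (T : ℕ) :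
    QueryAlgorithm ι G :=
  ⟨A.workSize, A.uncomputeGate V T⟩

/-- The states of `A.uncompute V T` as elements of the state space of `A`. -/
noncomputable def QueryAlgorithm.uncomputeState (A : QueryAlgorithm ι G)
    (V : StateSpace ι G A.workSize ≃ₗᵢ[ℂ] StateSpace ι G A.workSize) (T : ℕ) (z : ι → G) (t : ℕ) :
    StateSpace ι G A.workSize :=
  (A.uncompute V T).state z t

theorem QueryAlgorithm.norm_state (A : QueryAlgorithm ι G) (z : ι → G) (T : ℕ) :
    ‖A.state z T‖ = 1 := by
  induction T with
  | zero => simp [QueryAlgorithm.state]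
  | succ T ih => simp [QueryAlgorithm.state, ih]

variable (A : QueryAlgorithm ι G)
  (V : StateSpace ι G A.workSize ≃ₗᵢ[ℂ] StateSpace ι G A.workSize) (T : ℕ) (z : ι → G)

theorem QueryAlgorithm.state_succ (t : ℕ) :
    A.state z (t + 1) = A.gate (t + 1) (oracle A.workSize z (A.state z t)) := rfl

theorem QueryAlgorithm.uncomputeState_zero :
    A.uncomputeState V T z 0 = A.uncomputeGate V T 0 ((A.gate 0).symm (A.state z 0)) :=
  congrArg (A.uncomputeGate V T 0) (LinearIsometryEquiv.symm_apply_apply (A.gate 0) _).symm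

theorem QueryAlgorithm.uncomputeState_succ (t : ℕ) :
    A.uncomputeState V T z (t + 1) =
      A.uncomputeGate V T (t + 1) (oracle A.workSize z (A.uncomputeState V T z t)) := rfl

theorem QueryAlgorithm.uncomputeState_of_lt {t : ℕ} (ht : t < T) :
    A.uncomputeState V T z t = A.state z t := by
  induction t with
  | zero =>
    rw [QueryAlgorithm.uncomputeState_zero, QueryAlgorithm.uncomputeGate, if_pos ht,
      LinearIsometryEquiv.apply_symm_apply]
  | succ t ih =>
    rw [QueryAlgorithm.uncomputeState_succ, QueryAlgorithm.uncomputeGate, if_pos ht,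
      ih (by omega), QueryAlgorithm.state_succ]

theorem QueryAlgorithm.uncomputeState_self :
    A.uncomputeState V T z T =
      negateAnswer ι G A.workSize ((A.gate T).symm (V (A.state z T))) := by
  cases T with
  | zero =>
    rw [QueryAlgorithm.uncomputeState_zero]
    simp [QueryAlgorithm.uncomputeGate]
  | succ T =>
    rw [QueryAlgorithm.uncomputeState_succ,
      A.uncomputeState_of_lt V (T + 1) z (Nat.lt_succ_self T), QueryAlgorithm.state_succ]
    simp [QueryAlgorithm.uncomputeGate]

/-- The second vector is the state the backward run would have if V were the identity. Both evolve
under the same unitaries, so their inner product stays constant; at s = T this reference vector no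
longer depends on z. -/
theorem QueryAlgorithm.inner_uncomputeState {s : ℕ} (hs : s ≤ T) :
    inner ℂ (A.uncomputeState V T z (T + s))
      (negateAnswer ι G A.workSize ((A.gate (T - s)).symm (A.state z (T - s)))) =
        inner ℂ (V (A.state z T)) (A.state z T) := by
  induction s with
  | zero =>
    rw [Nat.add_zero T, Nat.sub_zero, A.uncomputeState_self V T z,
      LinearIsometryEquiv.inner_map_map, LinearIsometryEquiv.inner_map_map]
  | succ s ih =>
    rw [← ih (by omega)]
    obtain ⟨r, hr⟩ : ∃ r, T - s = r + 1 := ⟨T - s - 1, by omega⟩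
    have hr' : T - (s + 1) = r := by omega
    have hst : A.uncomputeState V T z (T + s + 1) = negateAnswer ι G A.workSize
        ((A.gate r).symm (negateAnswer ι G A.workSize (oracle A.workSize z
          (A.uncomputeState V T z (T + s))))) := by
      have h1 : ¬ T + s + 1 < T := by omega
      have h2 : ¬ T + s + 1 = T := by omega
      have h3 : 2 * T - (T + s + 1) = r := by omega
      rw [QueryAlgorithm.uncomputeState_succ, QueryAlgorithm.uncomputeGate, if_neg h1, if_neg h2,
        h3]
      rfl
    have hR : negateAnswer ι G A.workSize (oracle A.workSize z
        (negateAnswer ι G A.workSize ((A.gate (r + 1)).symm (A.state z (r + 1))))) =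
          A.state z r := by
      rw [QueryAlgorithm.state_succ, LinearIsometryEquiv.symm_apply_apply]
      exact negateAnswer_oracle_negateAnswer_oracle _ _ _
    rw [← add_assoc, hst, hr', hr, LinearIsometryEquiv.inner_map_map,
      LinearIsometryEquiv.inner_map_map, ← hR, LinearIsometryEquiv.inner_map_map,
      LinearIsometryEquiv.inner_map_map]

/-- The overlap is Pr[out = 0] - Pr[out = 1]; the sign of a turns it into Pr[out = a] minus the
complementary probability. -/
theorem re_inner_phaseFlip {S : Type*} [Fintype S] (out : S → ZMod 2) (ψ : EuclideanSpace ℂ S)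
    (hψ : ‖ψ‖ = 1) (a : ZMod 2) :
    phaseSign id a * (inner ℂ (phaseFlip out ψ) ψ).re =
      2 * ∑ s with out s = a, ‖ψ s‖ ^ 2 - 1 := by
  have h1 : (inner ℂ (phaseFlip out ψ) ψ).re = ∑ s, phaseSign id (out s) * ‖ψ s‖ ^ 2 := by
    rw [← sum_star_mul_eq_inner, Complex.re_sum]
    refine Finset.sum_congr rfl fun s _ => ?_
    rw [phaseFlip_apply, star_mul', mul_assoc, Complex.star_def,
      Complex.conj_ofReal, Complex.re_ofReal_mul, ← Complex.normSq_eq_conj_mul_self,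
      Complex.ofReal_re, Complex.normSq_eq_norm_sq]
    rfl
  have h2 : ∑ s, ‖ψ s‖ ^ 2 = 1 := by rw [← EuclideanSpace.norm_sq_eq, hψ, one_pow]
  rw [h1, Finset.sum_filter, Finset.mul_sum, Finset.mul_sum, ← h2, ← Finset.sum_sub_distrib]
  refine Finset.sum_congr rfl fun s _ => ?_
  rw [← mul_assoc, phaseSign_mul_phaseSign, id, id]
  by_cases h : out s = a
  · rw [if_pos h, if_pos h.symm]
    ring
  · rw [if_neg h, if_neg (Ne.symm h)]
    ring

/-- An algorithm computing a bit with advantage `c` over guessing yields one with twice as many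
queries which computes it in the phase with overlap `c`. -/
theorem ComputesWithError.generatesCoherently {K D : Type*} {enc : D ↪ G} {str : K → ι → D}
    {g : K → ZMod 2} {c : ℝ} (hc : 0 ≤ c) {T : ℕ}
    (h : ComputesWithError enc str g ((1 - c) / 2) T) :
    GeneratesCoherently enc str (fun x y => (phaseSign g x : ℂ) * phaseSign g y) (1 - c ^ 2)
      (T + T) := by
  obtain ⟨A, out, hA⟩ := h
  set e : StateSpace ι G A.workSize :=
    negateAnswer ι G A.workSize ((A.gate 0).symm (A.state 0 0)) with he
  have hnorm : ‖e‖ = 1 := by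
    rw [he, LinearIsometryEquiv.norm_map, LinearIsometryEquiv.norm_map, A.norm_state]
  refine ⟨A.uncompute (phaseFlip out) T, fun x => (phaseSign g x : ℂ) • e, fun x y => ?_,
    fun x => ?_⟩
  · change inner ℂ ((phaseSign g x : ℂ) • e) ((phaseSign g y : ℂ) • e) = _
    rw [inner_smul_left, inner_smul_right, Complex.conj_ofReal, inner_self_eq_norm_sq_to_K, hnorm]
    simp
  · have h1 := A.inner_uncomputeState (phaseFlip out) T (fun i => enc (str x i)) le_rfl
    rw [Nat.sub_self] at h1
    have h2 : (inner ℂ (A.uncomputeState (phaseFlip out) T (fun i => enc (str x i)) (T + T))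
        ((phaseSign g x : ℂ) • e)).re =
        2 * ∑ s with out s = g x, ‖A.state (fun i => enc (str x i)) T s‖ ^ 2 - 1 := by
      rw [← re_inner_phaseFlip out _ (A.norm_state _ T) (g x), ← h1, inner_smul_right,
        Complex.re_ofReal_mul]
      rfl
    rw [sub_sub_cancel, Real.sqrt_sq hc]
    -- Success probability at least (1 + c)/2 gives 2(1 + c)/2 - 1 = c.
    refine le_trans ?_ h2.ge
    linarith [hA x]

end Uncompute

/-! ### Parity as a product of signs, and passage to the optimal values. -/

theorem phaseSign_parityOfCopies {X : Type*} (k : ℕ) (f : X → ZMod 2) (x : Fin k → X) :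
    phaseSign (parityOfCopies k f) x = ∏ p, phaseSign f (x p) := by
  have hadd : ∀ a b : ZMod 2, phaseSign id (a + b) = phaseSign id a * phaseSign id b := by
    have key : ∀ a b : ZMod 2, ((-1 : ℤ) ^ (a + b).val) = (-1) ^ a.val * (-1) ^ b.val := by
      decide
    intro a b
    have := congrArg (Int.cast : ℤ → ℝ) (key a b)
    push_cast at this
    exact this
  have hsum : ∀ s : Finset (Fin k),
      phaseSign id (∑ p ∈ s, f (x p)) = ∏ p ∈ s, phaseSign f (x p) := by
    intro s
    induction s using Finset.induction_on with
    | empty => simp [phaseSign]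
    | insert p s hp ih =>
      rw [Finset.sum_insert hp, Finset.prod_insert hp, hadd, ih]
      rfl
  exact hsum Finset.univ

theorem le_toENNReal_iInf_natCast {p : ℕ → Prop} {c : ℝ≥0∞} (h : ∀ T, p T → c ≤ (T : ℝ≥0∞)) :
    c ≤ ((⨅ (T : ℕ) (_ : p T), (T : ℕ∞) : ℕ∞) : ℝ≥0∞) := by
  by_cases hp : ∃ T, p T
  · classical
    have hle : ((Nat.find hp : ℕ) : ℕ∞) ≤ ⨅ (T : ℕ) (_ : p T), (T : ℕ∞) :=
      le_iInf₂ fun T hT => Nat.cast_le.mpr (Nat.find_min' hp hT)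
    refine (h _ (Nat.find_spec hp)).trans ?_
    rw [← ENat.toENNReal_coe]
    exact ENat.toENNReal_le.mpr hle
  · have htop : (⨅ (T : ℕ) (_ : p T), (T : ℕ∞)) = ⊤ := by
      simp only [iInf_eq_top]
      exact fun T hT => (hp ⟨T, hT⟩).elim
    rw [htop, ENat.toENNReal_top]
    exact le_top

theorem mul_additiveAdversary_le {X ι D : Type*} [Fintype X] [DecidableEq X] [DecidableEq D]
    {str : X → ι → D} {σ : Matrix X X ℂ} {a : ℝ} (ha : 0 ≤ a) {T : ℕ}
    (h : ∀ Γ, IsAdversaryMatrix str Γ →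
      a * ‖Matrix.toEuclideanCLM (𝕜 := ℂ) (Γ ⊙ (allOnes X - σ))‖ ≤ T) :
    ENNReal.ofReal a * additiveAdversary str σ ≤ T := by
  unfold additiveAdversary
  simp only [ENNReal.mul_iSup]
  refine iSup₂_le fun Γ hΓ => ?_
  rw [← ENNReal.ofReal_mul ha, ← ENNReal.ofReal_natCast]
  exact ENNReal.ofReal_le_ofReal (h Γ hΓ)

theorem mainTheorem6 {D G : Type*} [Finite D] [DecidableEq D] [Fintype G] [AddCommGroup G]
    (enc : D ↪ G) (n : ℕ) (𝒟 : Finset (Fin n → D)) (f : 𝒟 → ZMod 2)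
    (δ : ℝ) (hδ0 : 0 ≤ δ) (hδ1 : δ ≤ 1) (k : ℕ) (hk : 0 < k) :
    (k : ℝ≥0∞) * ENNReal.ofReal δ / 4 *
        additiveAdversary (fun x : 𝒟 => x.val) (functionGram f) ≤
      (coherentQuery enc (tupleString k (fun x : 𝒟 => x.val)) (tensorPower k (phaseGram f))
        (1 - δ ^ k) : ℝ≥0∞) ∧
    (k : ℝ≥0∞) * ENNReal.ofReal δ / 8 *
        additiveAdversary (fun x : 𝒟 => x.val) (functionGram f) ≤
      (quantumQuery enc (tupleString k (fun x : 𝒟 => x.val)) (parityOfCopies k f)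
        ((1 - δ ^ ((k : ℝ) / 2)) / 2) : ℝ≥0∞) := by
  have hcoef : ∀ c : ℕ, 0 < c →
      (k : ℝ≥0∞) * ENNReal.ofReal δ / (c : ℝ≥0∞) = ENNReal.ofReal (k * δ / c) := by
    intro c hc
    rw [ENNReal.ofReal_div_of_pos (Nat.cast_pos.mpr hc), ENNReal.ofReal_mul k.cast_nonneg,
      ENNReal.ofReal_natCast, ENNReal.ofReal_natCast]
  have h4 := hcoef 4 (by norm_num)
  have h8 := hcoef 8 (by norm_num)
  push_cast at h4 h8
  refine ⟨?_, ?_⟩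
  · refine le_toENNReal_iInf_natCast fun T hT => ?_
    rw [h4]
    exact mul_additiveAdversary_le (by positivity) fun Γ hΓ => hT.le_queries hδ0 hδ1 hΓ
  · refine le_toENNReal_iInf_natCast fun T hT => ?_
    rw [h8]
    refine mul_additiveAdversary_le (by positivity) fun Γ hΓ => ?_
    -- The advantage c = δ^{k/2} has c² = δ^k, the error parameter of the first part, now with T + T
    -- queries; halving gives kδ/8.
    have h1 := hT.generatesCoherently (Real.rpow_nonneg hδ0 _)
    have h2 : (fun x y => (phaseSign (parityOfCopies k f) x : ℂ) *
        phaseSign (parityOfCopies k f) y) = tensorPower k (phaseGram f) := by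
      funext x y
      rw [tensorPower_phaseGram_apply, phaseSign_parityOfCopies, phaseSign_parityOfCopies]
    have h3 : (δ ^ ((k : ℝ) / 2)) ^ 2 = δ ^ k := by
      rw [← Real.rpow_mul_natCast hδ0, ← Real.rpow_natCast]
      congr 1
      push_cast
      ring
    rw [h2, h3] at h1
    have h5 := h1.le_queries hδ0 hδ1 hΓ
    push_cast at h5
    linarith
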